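/- Let $S$ be a semigroup and let $\sigma : S\to S$ be an involutive automorphism, that is, $\sigma(xy)=\sigma(x)\sigma(y)$ and $\sigma(\sigma(x))=x$ for all $x,y\in S$. Let $g:S\to\mathbb{C}$ be a solution of d'Alembert's functional equation $$g(xy)+g(x\sigma(y))=2g(x)g(y),\qquad x,y\in S.$$ Suppose that there exists a complex measure $\mu$ on $S$ (on the $\sigma$-algebra of all subsets, or on any $\sigma$-algebra containing the singletons) which is a finite complex linear combination of Dirac measures $\delta_{z_i}$, with every $z_i$ in the center of $S$, such that $$\int_S g(t)\,d\mu(t)=0\qquad\text{and}\qquad \int_S\int_S g(ts)\,d\mu(t)\,d\mu(s)\neq 0.$$ Then there exists a multiplicative function $\chi:S\to\mathbb{C}$ (that is, $\chi(xy)=\chi(x)\chi(y)$ for all $x,y\in S$), not identically zero, such that $$g=\frac{\chi+\chi\circ\sigma}{2}.$$ -/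

import Mathlib

namespace DAlembert

open MeasureTheory

/-- `g : S → ℂ` solves d'Alembert's functional equation
`g (x y) + g (x σ(y)) = 2 g(x) g(y)` for all `x, y`. -/
def IsSolution {S : Type*} [Semigroup S] (σ : S → S) (g : S → ℂ) : Prop :=
  ∀ x y : S, g (x * y) + g (x * σ y) = 2 * g x * g y

/-- `χ : S → ℂ` is multiplicative (it is allowed to vanish). -/
def IsMultiplicative {S : Type*} [Semigroup S] (χ : S → ℂ) : Prop :=
  ∀ x y : S, χ (x * y) = χ x * χ y

/-- `σ` is an involutive automorphism of the semigroup `S`. -/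
structure IsInvolutiveAutomorphism {S : Type*} [Semigroup S] (σ : S → S) : Prop where
  map_mul : ∀ x y : S, σ (x * y) = σ x * σ y
  involutive : ∀ x : S, σ (σ x) = x

/-- The complex measure `μ` is a (finite) complex linear combination of Dirac measures `δ_z`
at points `z` of the center of `S`. -/
def IsCentralDiracCombination {S : Type*} [Semigroup S] [MeasurableSpace S]
    (μ : ComplexMeasure S) : Prop :=
  μ ∈ Submodule.span ℂ
    ((fun z : S => (VectorMeasure.dirac z 1 : ComplexMeasure S)) '' Set.center S)

/-- The integral `∫ f dμ` of a complex-valued function against a complex measure, i.e. the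
integral against a vector measure for the pairing given by multiplication of complex numbers. -/
noncomputable def cintegral {S : Type*} [MeasurableSpace S]
    (μ : ComplexMeasure S) (f : S → ℂ) : ℂ :=
  VectorMeasure.integral μ f (ContinuousLinearMap.mul ℝ ℂ)

end DAlembert

namespace DAlembert

open MeasureTheory

/-! Let `L` be integration against μ and h(x) = L(t ↦ g(xt)). Centrality and L g = 0 make h obey the
sine addition law with g (`translate_mul_eq`). Translating once more gives a multiple c·g with c ≠ 0
(`exists_translate_translate_eq`), hence c·g(xy) = c·g(x)g(y) + h(x)h(y). With d² = c and a = h/d,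
the pair (g, a) behaves like (cosh, sinh), so χ = g + a is multiplicative and χ ∘ σ = g - a. -/

/-- The integral against a combination of Dirac measures at central points is a linear functional
which only depends on the values at the center. -/
lemma IsCentralDiracCombination.exists_linearMap {S : Type*} [Semigroup S] [MeasurableSpace S]
    [MeasurableSingletonClass S] {μ : ComplexMeasure S} (hμ : IsCentralDiracCombination μ) :
    ∃ L : (S → ℂ) →ₗ[ℂ] ℂ, (∀ f, cintegral μ f = L f) ∧
      ∀ f₁ f₂ : S → ℂ, Set.EqOn f₁ f₂ (Set.center S) → L f₁ = L f₂ := by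
  obtain ⟨l, hl, rfl⟩ := (Finsupp.mem_span_image_iff_linearCombination ℂ).1 hμ
  have hdirac (z : S) (c : ℂ) :
      c • (VectorMeasure.dirac z 1 : ComplexMeasure S) = VectorMeasure.dirac z c := by
    ext s hs
    by_cases hz : z ∈ s <;> simp [hz, hs]
  refine ⟨∑ z ∈ l.support, l z • LinearMap.proj z, fun f ↦ ?_, fun f₁ f₂ h ↦ ?_⟩
  · have hint (z : S) (c : ℂ) : (VectorMeasure.dirac z c : ComplexMeasure S).Integrable f := by
      -- `f` need not be measurable, but it is a.e. constant for a Dirac mass since singletons are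
      -- measurable.
      have hconst : f =ᵐ[(VectorMeasure.dirac z c : ComplexMeasure S).variation]
          fun _ ↦ f z := by
        rw [VectorMeasure.variation_dirac]
        exact Measure.ae_smul_measure (ae_eq_dirac f) _
      exact (integrable_const (f z)).congr hconst.symm
    rw [cintegral, Finsupp.linearCombination_apply, Finsupp.sum]
    simp only [hdirac]
    rw [VectorMeasure.integral_finsetSum_vectorMeasure (fun z _ ↦ hint z _)]
    simp [VectorMeasure.integral_dirac, mul_comm]
  · simp only [LinearMap.sum_apply, LinearMap.smul_apply, LinearMap.proj_apply]
    exact Finset.sum_congr rfl fun z hz ↦ by rw [h ((Finsupp.mem_supported ℂ l).1 hl hz)]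

/-- Linearity of a functional on a combination of two functions. -/
lemma map_combination {S : Type*} (L : (S → ℂ) →ₗ[ℂ] ℂ) (a b : ℂ) (u v : S → ℂ) :
    L (fun t ↦ a * u t + b * v t) = a * L u + b * L v := by
  have h : (fun t ↦ a * u t + b * v t) = a • u + b • v := by ext; simp
  simp [h]

section Translate

variable {S : Type*} [Semigroup S] {σ : S → S} {g : S → ℂ} {L : (S → ℂ) →ₗ[ℂ] ℂ}

/-- The convolution of `f` with the functional `L`. -/
def translate (L : (S → ℂ) →ₗ[ℂ] ℂ) (f : S → ℂ) (x : S) : ℂ := L fun t ↦ f (x * t)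

lemma translate_mul (hL : ∀ f₁ f₂ : S → ℂ, Set.EqOn f₁ f₂ (Set.center S) → L f₁ = L f₂)
    (f : S → ℂ) (x y : S) : translate L f (x * y) = L fun t ↦ f (x * t * y) :=
  hL _ _ fun t ht ↦ by
    show f (x * y * t) = f (x * t * y)
    rw [mul_assoc, mul_assoc, (Set.mem_center_iff.1 ht).comm y]

/-- Centrality moves t next to x; then apply `L` in t to the equation for (xt, y). -/
lemma IsSolution.translate_add (hg : IsSolution σ g)
    (hL : ∀ f₁ f₂ : S → ℂ, Set.EqOn f₁ f₂ (Set.center S) → L f₁ = L f₂) (x y : S) :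
    translate L g (x * y) + translate L g (x * σ y) = 2 * translate L g x * g y := by
  have h := map_combination L 1 1 (fun t ↦ g (x * t * y)) fun t ↦ g (x * t * σ y)
  have h' := map_combination L (2 * g y) 0 (fun t ↦ g (x * t)) 0
  rw [translate_mul hL, translate_mul hL]
  simp only [one_mul, hg _ y] at h
  rw [← h]
  simp only [zero_mul, add_zero] at h'
  rw [translate, mul_right_comm, ← h']
  congr 1; ext t; ring

/-- Apply `L` in t to the equation for (x, yt). Since `L g = 0`, replacing t by σ(t) under `L` only
flips the sign. -/
lemma IsSolution.translate_sub (hg : IsSolution σ g) (hσ : ∀ x y, σ (x * y) = σ x * σ y)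
    (hgL : L g = 0) (x y : S) :
    translate L g (x * y) - translate L g (x * σ y) = 2 * g x * translate L g y := by
  have h (u : S) : L (fun t ↦ g (u * σ t)) = - translate L g u := by
    have h' := map_combination L (2 * g u) (-1) g fun t ↦ g (u * t)
    rw [hgL] at h'
    have h'' : (fun t ↦ g (u * σ t)) = fun t ↦ 2 * g u * g t + -1 * g (u * t) := by
      ext t; linear_combination hg u t
    rw [h'', h', translate]; ring
  have h₁ := map_combination L (2 * g x) (-1) (fun t ↦ g (y * t)) fun t ↦ g (x * y * t)
  have h₂ : (fun t ↦ 2 * g x * g (y * t) + -1 * g (x * y * t)) = fun t ↦ g (x * σ y * σ t) := by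
    ext t
    have := hg x (y * t)
    rw [hσ, ← mul_assoc, ← mul_assoc] at this
    linear_combination -this
  rw [h₂, h] at h₁
  simp only [translate] at h₁ ⊢
  linear_combination h₁

/-- The translate satisfies the sine addition law. -/
lemma IsSolution.translate_mul_eq (hg : IsSolution σ g) (hσ : ∀ x y, σ (x * y) = σ x * σ y)
    (hL : ∀ f₁ f₂ : S → ℂ, Set.EqOn f₁ f₂ (Set.center S) → L f₁ = L f₂) (hgL : L g = 0)
    (x y : S) : translate L g (x * y) = translate L g x * g y + g x * translate L g y := by
  linear_combination (hg.translate_add hL x y + hg.translate_sub hσ hgL x y) / 2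

/-- The second translate of a solution annihilated by `L` is proportional to it, with a nonzero
factor. -/
lemma IsSolution.exists_translate_translate_eq (hg : IsSolution σ g)
    (hσ : ∀ x y, σ (x * y) = σ x * σ y)
    (hL : ∀ f₁ f₂ : S → ℂ, Set.EqOn f₁ f₂ (Set.center S) → L f₁ = L f₂) (hgL : L g = 0)
    (hgLL : L (translate L g) ≠ 0) :
    ∃ c : ℂ, c ≠ 0 ∧ ∀ x y, c * g (x * y) = c * (g x * g y) + translate L g x * translate L g y := by
  have hsine := hg.translate_mul_eq hσ hL hgL
  have hleft (x y : S) : translate L (translate L g) (x * y) =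
      translate L g x * translate L g y + g x * translate L (translate L g) y := by
    have h := map_combination L (translate L g x) (g x) (fun t ↦ g (y * t))
      fun t ↦ translate L g (y * t)
    simp only [← hsine, ← mul_assoc] at h
    exact h
  have hright (x y : S) : translate L (translate L g) (x * y) =
      translate L (translate L g) x * g y + translate L g x * translate L g y := by
    have h := map_combination L (g y) (translate L g y) (fun t ↦ translate L g (x * t))
      fun t ↦ g (x * t)
    rw [translate_mul hL]
    simp only [hsine (x * _) y]
    calc _ = _ := by congr 1; ext t; ring
      _ = _ := h
      _ = _ := by simp only [translate]; ring
  obtain ⟨z, hz⟩ : ∃ z, g z ≠ 0 := by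
    by_contra! h
    have : translate L g = 0 := by
      ext x
      have : (fun t ↦ g (x * t)) = 0 := by ext; simp [h]
      simp [translate, this]
    simp [this] at hgLL
  -- The two expansions of the second translate k force g(x)k(z) = k(x)g(z).
  have hprop (x : S) : translate L (translate L g) x =
      translate L (translate L g) z / g z * g x := by
    field_simp
    linear_combination hleft x z - hright x z
  refine ⟨translate L (translate L g) z / g z, fun h0 ↦ hgLL ?_, fun x y ↦ ?_⟩
  · simp only [h0, zero_mul] at hprop
    -- If c = 0 then k = 0, and `hleft x x` reduces to h(x)² = 0.
    have : translate L g = 0 := by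
      ext x
      have := hleft x x
      simpa [hprop] using this
    simp [this]
  · have h := hleft x y
    rw [hprop (x * y), hprop y] at h
    linear_combination h

end Translate

end DAlembert

theorem corollary4p4 {S : Type*} [Semigroup S] [MeasurableSpace S] [MeasurableSingletonClass S]
    (σ : S → S) (hσ : DAlembert.IsInvolutiveAutomorphism σ)
    (g : S → ℂ) (hg : DAlembert.IsSolution σ g)
    (hμ : ∃ μ : MeasureTheory.ComplexMeasure S, DAlembert.IsCentralDiracCombination μ ∧
      DAlembert.cintegral μ g = 0 ∧
      DAlembert.cintegral μ (fun s => DAlembert.cintegral μ (fun t => g (t * s))) ≠ 0) :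
    ∃ χ : S → ℂ, DAlembert.IsMultiplicative χ ∧ χ ≠ 0 ∧
      ∀ x : S, g x = (χ x + χ (σ x)) / 2 := by
  obtain ⟨μ, hμ, hgL, hgLL⟩ := hμ
  obtain ⟨L, hμL, hL⟩ := hμ.exists_linearMap
  have hcomm : (fun s ↦ L fun t ↦ g (t * s)) = DAlembert.translate L g := by
    ext s
    exact hL _ _ fun t ht ↦ congrArg g ((Set.mem_center_iff.1 ht).comm s)
  simp only [hμL] at hgL hgLL
  rw [hcomm] at hgLL
  have hsine := hg.translate_mul_eq hσ.map_mul hL hgL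
  have hdiff := hg.translate_sub hσ.map_mul hgL
  obtain ⟨c, hc, hcos⟩ := hg.exists_translate_translate_eq hσ.map_mul hL hgL hgLL
  obtain ⟨d, rfl⟩ := IsAlgClosed.exists_pow_nat_eq c two_pos
  have hd : d ≠ 0 := by rintro rfl; simp at hc
  set a : S → ℂ := fun x ↦ DAlembert.translate L g x / d with ha
  have hLa (x : S) : DAlembert.translate L g x = d * a x := by simp only [ha]; field_simp
  simp only [hLa] at hsine hdiff hcos
  have hsin (x y : S) : a (x * y) = a x * g y + g x * a y :=
    mul_left_cancel₀ hd (by linear_combination hsine x y)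
  have hsin' (x y : S) : a (x * y) - a (x * σ y) = 2 * g x * a y :=
    mul_left_cancel₀ hd (by linear_combination hdiff x y)
  have hcos' (x y : S) : g (x * y) = g x * g y + a x * a y :=
    mul_left_cancel₀ hc (by linear_combination hcos x y)
  -- If χ = 0 then h = -d·g, so L h = -d·L g = 0.
  have hχ : (fun x ↦ g x + a x) ≠ 0 := fun h ↦ hgLL <| by
    have : DAlembert.translate L g = -d • g := by
      ext x
      have := congrFun h x
      simp only [Pi.zero_apply] at this
      simp only [hLa, Pi.smul_apply, smul_eq_mul]
      linear_combination d * this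
    rw [this, map_smul, hgL, smul_zero]
  refine ⟨fun x ↦ g x + a x, fun x y ↦ ?_, hχ, fun y ↦ ?_⟩
  · linear_combination hcos' x y + hsin x y
  · obtain ⟨x, hx⟩ := Function.ne_iff.1 hχ
    -- Compare χ(x)χ(σ(y)) = χ(xσ(y)) with χ(x)(g(y) - a(y)) at a point x where χ(x) ≠ 0.
    have key : g (σ y) + a (σ y) = g y - a y := mul_left_cancel₀ hx <| by
      show (g x + a x) * _ = (g x + a x) * _
      linear_combination hg x y - hsin' x y + hsin x y - hcos' x (σ y) - hsin x (σ y) - hcos' x y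
    linear_combination -key / 2
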